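/- Let $\Gamma=(\mathsf V,\mathsf E)$ be a finite simple graph, let $G_\Gamma=\langle v\in\mathsf V \mid vw=wv \text{ if } \{v,w\}\in\mathsf E\rangle$ be its right-angled Artin group, and fix a total ordering on $\mathsf V$. For a group $G$, let $H_1(G)=G/G'$; the Alexander invariant $B(G)=G'/G''$ is the $\mathbb Z[H_1(G)]$-module whose structure is induced by conjugation, $[g]\cdot[x]=[gxg^{-1}]$ for $g\in G$, $x\in G'$. Identify $\mathbb Z[H_1(G_\Gamma)]$ with the Laurent polynomial ring $\mathbb Z[\mathsf V^{\pm1}]$ by sending the class of each generator $v$ to the variable $v$. A non-edge is a $2$-element subset of $\mathsf V$ that is not in $\mathsf E$. For a $3$-element subset $t\subset\mathsf V$ and a $2$-element subset $e=\{u,w\}\subset t$ with $u<w$, let $v_e$ be the third vertex of $t$, and let $\epsilon_e\in\{1,-1\}$ be the sign of the permutation $(v_e,u,w)$ of the ordered set $t$. Theorem. The Alexander invariant $B(G_\Gamma)$ is isomorphic, as a $\mathbb Z[\mathsf V^{\pm1}]$-module, to the quotient of the free $\mathbb Z[\mathsf V^{\pm1}]$-module on the non-edges of $\Gamma$ by the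 submodule generated by the relators $$\sum_{e\subset t,\ e \text{ a non-edge}} \epsilon_e\,(v_e-1)\otimes e ,$$ one for each $3$-element subset $t\subset\mathsf V$ that is not a $3$-clique of $\Gamma$. -/

import Mathlib

open scoped commutatorElement

/-- The right-angled Artin group `G_Γ = ⟨v ∈ V ∣ v w = w v if {v, w} is an edge of Γ⟩`. -/
abbrev RightAngledArtinGroup {V : Type*} (Γ : SimpleGraph V) : Type _ :=
  PresentedGroup {r : FreeGroup V | ∃ v w : V, Γ.Adj v w ∧ r = ⁅FreeGroup.of v, FreeGroup.of w⁆}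

/-- The group `B(G) = G'/G''` underlying the Alexander invariant of `G`, written additively. -/
def AlexanderInvariant (G : Type*) [Group G] : Type _ :=
  Additive (Abelianization (commutator G))

namespace AlexanderInvariant

variable (G : Type*) [Group G]

instance : AddCommGroup (AlexanderInvariant G) :=
  inferInstanceAs (AddCommGroup (Additive (Abelianization (commutator G))))

variable {G} in
/-- The class in `G'/G''` of an element of `G'`. -/
def mk (x : commutator G) : AlexanderInvariant G := Additive.ofMul (Abelianization.of x)

/-- The action of `G` on `G'/G''` induced by conjugation `x ↦ g x g⁻¹`. -/
noncomputable def conjHom : G →* Module.End ℤ (AlexanderInvariant G) where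
  toFun g := (MonoidHom.toAdditive
    (Abelianization.map (MulAut.conjNormal (H := commutator G) g).toMonoidHom)).toIntLinearMap
  map_one' := by
    refine LinearMap.ext fun b => ?_
    obtain ⟨x, rfl⟩ := QuotientGroup.mk_surjective (s := commutator (commutator G)) b
    exact congrArg mk (by simp)
  map_mul' g h := by
    refine LinearMap.ext fun b => ?_
    obtain ⟨x, rfl⟩ := QuotientGroup.mk_surjective (s := commutator (commutator G)) b
    exact congrArg mk (by simp)

variable {G} in
theorem conjHom_mk (g : G) (x : commutator G) :
    conjHom G g (mk x) = mk (MulAut.conjNormal g x) := rfl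

/-- The action of `H₁(G) = G/G'` on `G'/G''` induced by conjugation: elements of `G'` act
trivially. -/
noncomputable def conjRep : Representation ℤ (Abelianization G) (AlexanderInvariant G) :=
  QuotientGroup.lift (commutator G) (conjHom G) fun g hg => by
    refine LinearMap.ext fun b => ?_
    obtain ⟨x, rfl⟩ := QuotientGroup.mk_surjective (s := commutator (commutator G)) b
    have h : (MulAut.conjNormal g x : commutator G) = ⟨g, hg⟩ * x * ⟨g, hg⟩⁻¹ :=
      Subtype.ext (by simp)
    refine (congrArg mk h).trans (congrArg Additive.ofMul ?_)
    rw [map_mul, map_mul, map_inv, mul_right_comm, mul_inv_cancel, one_mul]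
    rfl

/-- `B(G)` as a module over the group ring `ℤ[H₁(G)]`. -/
noncomputable instance : Module (MonoidAlgebra ℤ (Abelianization G)) (AlexanderInvariant G) :=
  Module.compHom (AlexanderInvariant G) (conjRep G).asAlgebraHom.toRingHom

variable {G} in
/-- The class of `g` in `H₁(G)` sends the class of `x ∈ G'` to the class of `g x g⁻¹`. -/
theorem single_of_smul_mk (g : G) (x : commutator G) :
    (MonoidAlgebra.single (Abelianization.of g) (1 : ℤ)) • mk x = mk (MulAut.conjNormal g x) := by
  change (conjRep G).asAlgebraHom (MonoidAlgebra.single (Abelianization.of g) (1 : ℤ)) (mk x) = _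
  rw [Representation.asAlgebraHom_single_one]
  rfl

end AlexanderInvariant

/-- The ring `ℤ[V^{±1}]` of Laurent polynomials with integer coefficients in variables labelled
by `V`. -/
abbrev LaurentRing (V : Type*) : Type _ := AddMonoidAlgebra ℤ (V →₀ ℤ)

/-- The variable of `ℤ[V^{±1}]` labelled by `v`. -/
noncomputable def LaurentRing.var {V : Type*} (v : V) : LaurentRing V :=
  AddMonoidAlgebra.single (Finsupp.single v 1) 1

namespace RightAngledArtinGroup

variable {V : Type*} (Γ : SimpleGraph V)

/-- The isomorphism from `H₁(G_Γ)` to the free abelian group on `V`. -/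
noncomputable def abelianizationEquiv :
    Abelianization (RightAngledArtinGroup Γ) ≃* Multiplicative (V →₀ ℤ) :=
  MonoidHom.toMulEquiv
    (Abelianization.lift (PresentedGroup.toGroup
      (f := fun v : V => Multiplicative.ofAdd (Finsupp.single v (1 : ℤ))) (by
        rintro r ⟨v, w, -, rfl⟩
        rw [map_commutatorElement, commutatorElement_eq_one_iff_mul_comm, mul_comm])))
    (AddMonoidHom.toMultiplicativeLeft (Finsupp.liftAddHom fun v : V =>
      (zmultiplesHom (Additive (Abelianization (RightAngledArtinGroup Γ))))
        (Additive.ofMul (Abelianization.of (PresentedGroup.of v)))))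
    (by
      ext v
      simp)
    (by
      refine MonoidHom.toAdditive.injective ?_
      ext v
      simp)

/-- The identification `ℤ[H₁(G_Γ)] ≃ ℤ[V^{±1}]` sending the class of the generator `v` to the
variable `v`. -/
noncomputable def groupRingEquiv :
    MonoidAlgebra ℤ (Abelianization (RightAngledArtinGroup Γ)) ≃+* LaurentRing V :=
  (MonoidAlgebra.domCongr ℤ ℤ (abelianizationEquiv Γ)).toRingEquiv.trans
    (AddMonoidAlgebra.toMultiplicative ℤ (V →₀ ℤ)).symm

theorem groupRingEquiv_of (v : V) :
    groupRingEquiv Γ (MonoidAlgebra.single (Abelianization.of (PresentedGroup.of v)) 1) =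
      LaurentRing.var v := by
  refine (RingEquiv.symm_apply_eq (AddMonoidAlgebra.toMultiplicative ℤ (V →₀ ℤ))).mpr ?_
  simp [abelianizationEquiv, LaurentRing.var]

/-- `B(G_Γ)` as a `ℤ[V^{±1}]`-module, through the identification of `ℤ[V^{±1}]` with
`ℤ[H₁(G_Γ)]`. -/
noncomputable instance :
    Module (LaurentRing V) (AlexanderInvariant (RightAngledArtinGroup Γ)) :=
  Module.compHom (AlexanderInvariant (RightAngledArtinGroup Γ))
    (groupRingEquiv Γ).symm.toRingHom

/-- The variable `v` acts on `G_Γ'/G_Γ''` by conjugation by the generator `v`. -/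
theorem var_smul_mk (v : V) (x : commutator (RightAngledArtinGroup Γ)) :
    LaurentRing.var v • AlexanderInvariant.mk x =
      AlexanderInvariant.mk (MulAut.conjNormal (PresentedGroup.of v) x) := by
  change (groupRingEquiv Γ).symm (LaurentRing.var v) • AlexanderInvariant.mk x = _
  rw [← groupRingEquiv_of Γ v, RingEquiv.symm_apply_apply]
  exact AlexanderInvariant.single_of_smul_mk _ x

end RightAngledArtinGroup

/-- The sign of the permutation `(a, b, c)` of a set of three elements of a linear order: the
product over all pairs of positions of `-1` if the pair is inverted and `1` otherwise. -/
def tripleSign {V : Type*} [LinearOrder V] (a b c : V) : ℤ :=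
  (if b < a then -1 else 1) * (if c < a then -1 else 1) * (if c < b then -1 else 1)

/-- The relator `∑ ε_e (v_e - 1) ⊗ e` attached to a set `t` of three vertices, in the free
`ℤ[V^{±1}]`-module on the non-edges of `Γ`. The sum is over the non-edges `e ⊆ t`; the inner sum
has exactly one term, the vertex `v_e` of `t` outside `e`, and `e = {e.inf, e.sup}` with
`e.inf < e.sup`. -/
noncomputable def alexanderRelator {V : Type*} [Fintype V] [LinearOrder V] (Γ : SimpleGraph V)
    [DecidableRel Γ.Adj] (t : Finset V) : Γᶜ.edgeSet →₀ LaurentRing V :=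
  ∑ e : Γᶜ.edgeSet with e.1.toFinset ⊆ t, ∑ v ∈ t \ e.1.toFinset,
    Finsupp.single e (tripleSign v e.1.inf e.1.sup • (LaurentRing.var v - 1))

/-- The `ℤ[V^{±1}]`-module generated by the non-edges of `Γ`, with one relator for each triple of
vertices that is not a `3`-clique of `Γ`. -/
abbrev AlexanderPresentation {V : Type*} [Fintype V] [LinearOrder V] (Γ : SimpleGraph V)
    [DecidableRel Γ.Adj] : Type _ :=
  (Γᶜ.edgeSet →₀ LaurentRing V) ⧸ Submodule.span (LaurentRing V)
    {r | ∃ t : Finset V, t.card = 3 ∧ ¬ Γ.IsNClique 3 t ∧ r = alexanderRelator Γ t}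

/-!
Write `G` for the right-angled Artin group, `P` for the presented module, `t ^ a` for the Laurent
monomial with exponent vector `a`, and `[u, w]` for the class in `B(G) = G'/G''` of the commutator
of the generators `u` and `w`.

Sending the non-edge `{u, w}` with `u < w` to `[u, w]` defines a linear map from the free module to
`B(G)`. For `a < b < c` the relator of `{a, b, c}` is `(a - 1) {b, c} - (b - 1) {a, c} +
(c - 1) {a, b}`, where edges of `Γ` are read as `0` (`alexanderRelator_triple`). It is sent to `0`
by the Hall–Witt identity modulo `G''` (`conjHom_bracket_jacobi`), so there is an induced map
`P → B(G)`. It is surjective because `G'` is the normal closure of the commutators of the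
generators (`eq_top_of_bracket_mem`).

Injectivity follows from a left inverse `B(G) → P` (`exists_linearMap_bracket`). Let `E u w` be the
class in `P` of `{u, w}`, read as `0` on edges. The relators say that the `P`-valued `2`-form
`(a, u, w) ↦ t ^ a • E u w` on the lattice `ℤ^V` is closed. A discrete Poincaré lemma
(`latticePrimitive_curl`) gives an explicit `1`-form with this curl, by integration over the region
between two lattice paths that follow the coordinate directions in increasing order. Let the
generator `v` act on `P × ℤ^V` by the inverse of `(p, a) ↦ (p + g v a, a + v)`, where `g` is this
`1`-form. Then the commutator of `u < w` acts by `(p, a) ↦ (p + t ^ a • E u w, a)`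
(`commutator_latticeStep_inv`), which is trivial if `u` and `w` are adjacent, so this is an action
of `G`. It follows that each element of `G'` acts by `(p, a) ↦ (p + t ^ a • q, a)` for a unique
`q`. The map `G' → P` that takes it to `q` is a homomorphism to an abelian group, compatible with
conjugation, so it factors through a linear map on `B(G)`, which sends `[u, w]` to `E u w`.
-/

/-! ### A discrete Poincaré lemma -/

/-- The `q`-integer `[n]_u = (u ^ n - 1) / (u - 1)` for a unit `u` and an integer `n`, as a signed
geometric sum. -/
noncomputable def geomSumInt {R : Type*} [CommRing R] (u : Rˣ) (n : ℤ) : R :=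
  ∑ k ∈ Finset.Ico 0 n, ((u ^ k : Rˣ) : R) - ∑ k ∈ Finset.Ico n 0, ((u ^ k : Rˣ) : R)

theorem geomSumInt_add_one {R : Type*} [CommRing R] (u : Rˣ) (n : ℤ) :
    geomSumInt u (n + 1) = geomSumInt u n + ((u ^ n : Rˣ) : R) := by
  unfold geomSumInt
  rcases le_or_gt 0 n with h | h
  · have h1 : Finset.Ico 0 (n + 1) = insert n (Finset.Ico 0 n) := by ext; simp; omega
    rw [h1, Finset.sum_insert (by simp), Finset.Ico_eq_empty (a := n + 1) (by omega),
      Finset.Ico_eq_empty (a := n) (by omega)]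
    ring
  · have h1 : Finset.Ico n 0 = insert n (Finset.Ico (n + 1) 0) := by ext; simp; omega
    rw [h1, Finset.sum_insert (by simp), Finset.Ico_eq_empty (b := n + 1) (by omega),
      Finset.Ico_eq_empty (b := n) (by omega)]
    ring

theorem sub_one_mul_geomSumInt {R : Type*} [CommRing R] (u : Rˣ) (n : ℤ) :
    ((u : R) - 1) * geomSumInt u n = ((u ^ n : Rˣ) : R) - 1 := by
  have step (m : ℤ) : (((u : R) - 1) * geomSumInt u (m + 1) = ((u ^ (m + 1) : Rˣ) : R) - 1) ↔
      ((u : R) - 1) * geomSumInt u m = ((u ^ m : Rˣ) : R) - 1 := by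
    rw [geomSumInt_add_one, zpow_add_one, Units.val_mul]
    constructor <;> intro h <;> linear_combination h
  induction n using Int.induction_on with
  | zero => simp [geomSumInt]
  | succ m ih => exact (step m).2 ih
  | pred m ih => exact (step _).1 (by simpa using ih)

theorem prod_zpow_add_single {V G : Type*} [DecidableEq V] [CommGroup G] (t : V → G) (a : V → ℤ)
    (v : V) (s : Finset V) :
    ∏ y ∈ s, t y ^ (a + Pi.single v 1 : V → ℤ) y =
      (if v ∈ s then t v else 1) * ∏ y ∈ s, t y ^ a y := by
  simp only [Pi.add_apply, zpow_add, Finset.prod_mul_distrib]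
  rw [mul_comm]
  congr 1
  rw [← Finset.prod_ite_eq' s v t]
  refine Finset.prod_congr rfl fun y _ => ?_
  rcases eq_or_ne y v with rfl | h <;> simp [*]

section Lattice

variable {V R M : Type*} [Fintype V] [LinearOrder V] [CommRing R] [AddCommGroup M] [Module R M]

/-- The coefficient `(∏ y < x, t y ^ a y) * [a x]_{t x}`: the sum of the monomials along the part
in direction `x` of the lattice path from `0` to `a` that follows the coordinate directions in
increasing order. -/
noncomputable def pathCoeff (t : V → Rˣ) (a : V → ℤ) (x : V) : R :=
  ((∏ y with y < x, t y ^ a y : Rˣ) : R) * geomSumInt (t x) (a x)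

theorem pathCoeff_add_single_of_gt (t : V → Rˣ) (a : V → ℤ) {v x : V} (h : x < v) :
    pathCoeff t (a + Pi.single v 1) x = pathCoeff t a x := by
  rw [pathCoeff, prod_zpow_add_single]
  simp [pathCoeff, h.not_gt, h.ne]

theorem pathCoeff_add_single_self (t : V → Rˣ) (a : V → ℤ) (v : V) :
    pathCoeff t (a + Pi.single v 1) v =
      pathCoeff t a v + ((∏ y with y < v, t y ^ a y : Rˣ) : R) * ((t v ^ a v : Rˣ) : R) := by
  rw [pathCoeff, prod_zpow_add_single]
  simp [pathCoeff, geomSumInt_add_one, mul_add]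

theorem pathCoeff_add_single_of_lt (t : V → Rˣ) (a : V → ℤ) {v x : V} (h : v < x) :
    pathCoeff t (a + Pi.single v 1) x = t v * pathCoeff t a x := by
  rw [pathCoeff, prod_zpow_add_single]
  simp [pathCoeff, h, h.ne', mul_assoc]

/-- A telescoping sum: each summand with `w < x` is `t ^ b - t ^ c`, where `b` and `c` are the
truncations of `a` to the coordinates `≤ x` and `< x`. -/
theorem sum_pathCoeff_mul (t : V → Rˣ) (a : V → ℤ) (w : V) :
    ((∏ y with y < w, t y ^ a y : Rˣ) : R) * ((t w ^ a w : Rˣ) : R) +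
      ∑ x with w < x, pathCoeff t a x * ((t x : R) - 1) = ((∏ y, t y ^ a y : Rˣ) : R) := by
  have hle : ((∏ y with y < w, t y ^ a y : Rˣ) : R) * ((t w ^ a w : Rˣ) : R) =
      ((∏ y with y ≤ w, t y ^ a y : Rˣ) : R) := by
    have : Finset.univ.filter (· ≤ w) = insert w (Finset.univ.filter (· < w)) := by
      ext; simp [le_iff_eq_or_lt]
    rw [this, Finset.prod_insert (by simp), Units.val_mul, mul_comm]
  have hall : (∏ y, t y ^ a y) = (∏ y with y ≤ w, t y ^ a y) * ∏ y with w < y, t y ^ a y := by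
    rw [← Finset.prod_filter_mul_prod_filter_not Finset.univ (· ≤ w)]
    simp only [not_le]
  have hord := Finset.prod_add_ordered (Finset.univ.filter (w < ·)) (fun _ => (1 : R))
    (fun x => ((t x ^ a x : Rˣ) : R) - 1)
  simp only [add_sub_cancel, Finset.prod_const_one, mul_one] at hord
  rw [hle, hall, Units.val_mul, Units.coe_prod (s := Finset.univ.filter (w < ·)), hord, mul_add,
    mul_one, Finset.mul_sum]
  congr 1
  refine Finset.sum_congr rfl fun x hx => ?_
  have hx : w < x := by simpa using hx
  have hlt : (∏ y with y < x, t y ^ a y) =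
      (∏ y with y ≤ w, t y ^ a y) * ∏ y ∈ Finset.univ.filter (w < ·) with y < x, t y ^ a y := by
    rw [← Finset.prod_filter_mul_prod_filter_not (Finset.univ.filter (· < x)) (· ≤ w)]
    congr 1 <;> refine Finset.prod_congr ?_ fun _ _ => rfl
    · ext y; simpa using fun h => h.trans_lt hx
    · ext y; simp [and_comm]
  rw [pathCoeff, mul_assoc, mul_comm (geomSumInt _ _), sub_one_mul_geomSumInt, hlt, Units.val_mul,
    ← Units.coe_prod]
  ring

/-- The `1`-form on the lattice `V → ℤ` whose value on the edge from `a` in direction `v` is the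
integral of the `2`-form `(a, u, w) ↦ t ^ a • E u w` over the region between the path to `a`
followed by this edge and the path to `a + v`. -/
noncomputable def latticePrimitive (t : V → Rˣ) (E : V → V → M) (v : V) (a : V → ℤ) : M :=
  ∑ x with v < x, pathCoeff t a x • E v x

/-- The discrete Poincaré lemma: if `E` satisfies the Jacobi identity, that is, if the `2`-form
`(a, u, w) ↦ t ^ a • E u w` on the lattice is closed, then it is the curl of
`latticePrimitive t E`. -/
theorem latticePrimitive_curl (t : V → Rˣ) (E : V → V → M)
    (hE : ∀ u w x, u < w → w < x →
      ((t u : R) - 1) • E w x - ((t w : R) - 1) • E u x + ((t x : R) - 1) • E u w = 0)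
    {u w : V} (h : u < w) (a : V → ℤ) :
    (latticePrimitive t E u (a + Pi.single w 1) - latticePrimitive t E u a) -
      (latticePrimitive t E w (a + Pi.single u 1) - latticePrimitive t E w a) =
      ((∏ y, t y ^ a y : Rˣ) : R) • E u w := by
  -- Only the summands with `w ≤ x` change when `a` moves in direction `w`.
  have h1 : latticePrimitive t E u (a + Pi.single w 1) - latticePrimitive t E u a =
      (((∏ y with y < w, t y ^ a y : Rˣ) : R) * ((t w ^ a w : Rˣ) : R)) • E u w +
        ∑ x with w < x, (((t w : R) - 1) * pathCoeff t a x) • E u x := by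
    rw [latticePrimitive, latticePrimitive, ← Finset.sum_sub_distrib,
      ← Finset.sum_subset (s₁ := insert w (Finset.univ.filter (w < ·))),
      Finset.sum_insert (by simp)]
    · congr 1
      · rw [pathCoeff_add_single_self, add_smul, add_sub_cancel_left]
      · refine Finset.sum_congr rfl fun x hx => ?_
        rw [pathCoeff_add_single_of_lt t a (by simpa using hx), sub_mul, one_mul, sub_smul]
    · intro x hx
      rcases Finset.mem_insert.1 hx with rfl | hx
      · simpa using h
      · simpa using h.trans (by simpa using hx)
    · intro x _ hx
      rw [pathCoeff_add_single_of_gt, sub_self]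
      simp only [Finset.mem_insert, Finset.mem_filter, Finset.mem_univ, true_and, not_or,
        not_lt] at hx
      exact lt_of_le_of_ne hx.2 hx.1
  have h2 : latticePrimitive t E w (a + Pi.single u 1) - latticePrimitive t E w a =
      ∑ x with w < x, (((t u : R) - 1) * pathCoeff t a x) • E w x := by
    rw [latticePrimitive, latticePrimitive, ← Finset.sum_sub_distrib]
    refine Finset.sum_congr rfl fun x hx => ?_
    rw [pathCoeff_add_single_of_lt t a (h.trans (by simpa using hx)), sub_mul, one_mul, sub_smul]
  -- The two remaining sums over `w < x` combine, by the Jacobi identity, into the telescoping sum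
  -- of `sum_pathCoeff_mul`.
  rw [h1, h2, add_sub_assoc, ← Finset.sum_sub_distrib, ← sum_pathCoeff_mul t a w, add_smul,
    Finset.sum_smul]
  congr 1
  refine Finset.sum_congr rfl fun x hx => ?_
  have := congrArg (pathCoeff t a x • ·) (hE u w x h (by simpa using hx))
  simp only [smul_add, smul_sub, smul_smul, smul_zero] at this
  rw [mul_comm _ (pathCoeff t a x), mul_comm _ (pathCoeff t a x), ← sub_eq_zero]
  rw [← neg_eq_zero, ← this]
  abel

end Lattice

/-! ### Commutator subgroups and the module structure -/

theorem commutator_le_of_closure_eq_top {G : Type*} [Group G] {S : Set G}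
    (hS : Subgroup.closure S = ⊤) (K : Subgroup G) [K.Normal]
    (h : ∀ a ∈ S, ∀ b ∈ S, ⁅a, b⁆ ∈ K) : commutator G ≤ K := by
  refine Subgroup.commutator_le.2 fun x hx y hy => ?_
  clear hx hy
  have hiff (x y : G) : ⁅x, y⁆ ∈ K ↔ Commute (x : G ⧸ K) y := by
    rw [← QuotientGroup.eq_one_iff, ← commutatorElement_eq_one_iff_commute]
    rfl
  rw [hiff]
  have hx : x ∈ Subgroup.closure S := hS ▸ Subgroup.mem_top x
  have hy : y ∈ Subgroup.closure S := hS ▸ Subgroup.mem_top y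
  induction hx, hy using Subgroup.closure_induction₂ with
  | mem a b ha hb => exact (hiff a b).1 (h a ha b hb)
  | one_left => exact Commute.one_left _
  | one_right => exact Commute.one_right _
  | mul_left a b c _ _ _ ha hb => exact Commute.mul_left ha hb
  | mul_right a b c _ _ _ ha hb => exact Commute.mul_right ha hb
  | inv_left a b _ _ ha => exact Commute.inv_left ha
  | inv_right a b _ _ ha => exact Commute.inv_right ha

namespace AlexanderInvariant

variable {G : Type*} [Group G]

theorem mk_mul (x y : commutator G) : mk (x * y) = mk x + mk y :=
  congrArg Additive.ofMul (map_mul Abelianization.of x y)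

theorem mk_inv (x : commutator G) : mk x⁻¹ = - mk x :=
  congrArg Additive.ofMul (map_inv Abelianization.of x)

theorem mk_one : mk (1 : commutator G) = 0 :=
  congrArg Additive.ofMul (map_one Abelianization.of)

theorem mk_surjective : Function.Surjective (mk : commutator G → AlexanderInvariant G) :=
  QuotientGroup.mk_surjective (s := commutator (commutator G))

/-- The class in `G'/G''` of the commutator of two elements of `G`. -/
def bracket (x y : G) : AlexanderInvariant G :=
  mk ⟨⁅x, y⁆, Subgroup.commutator_mem_commutator (Subgroup.mem_top x) (Subgroup.mem_top y)⟩

theorem bracket_swap (x y : G) : bracket y x = -bracket x y := by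
  rw [bracket, bracket, ← mk_inv]
  exact congrArg mk (Subtype.ext (commutatorElement_inv x y).symm)

/-- The Hall–Witt identity modulo `G''`. Both sides of the underlying identity in `G'` compute
`⁅a * b, c⁆`, the second one as `⁅⁅a, b⁆ * (b * a), c⁆`. -/
theorem conjHom_bracket_jacobi (a b c : G) :
    (conjHom G a (bracket b c) - bracket b c) - (conjHom G b (bracket a c) - bracket a c) +
      (conjHom G c (bracket a b) - bracket a b) = 0 := by
  let k (x y : G) : commutator G :=
    ⟨⁅x, y⁆, Subgroup.commutator_mem_commutator (Subgroup.mem_top x) (Subgroup.mem_top y)⟩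
  have key : MulAut.conjNormal a (k b c) * k a c = k a b * (MulAut.conjNormal b (k a c) * k b c) *
      (k a b)⁻¹ * (k a b * (MulAut.conjNormal c (k a b))⁻¹) := by
    refine Subtype.ext ?_
    simp only [Subgroup.coe_mul, MulAut.conjNormal_apply, Subgroup.coe_inv, k,
      commutatorElement_def]
    group
  have := congrArg mk key
  simp only [mk_mul, mk_inv, ← conjHom_mk] at this
  change conjHom G a (bracket b c) + bracket a c = bracket a b +
    (conjHom G b (bracket a c) + bracket b c) + -bracket a b +
      (bracket a b + -(conjHom G c (bracket a b))) at this
  rw [← sub_eq_zero] at this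
  rw [← this]
  abel

end AlexanderInvariant

namespace LaurentRing

variable {V : Type*}

/-- The variable labelled by `v` as a unit of the Laurent polynomial ring. -/
noncomputable def varUnit (v : V) : (LaurentRing V)ˣ where
  val := var v
  inv := AddMonoidAlgebra.single (Finsupp.single v (-1)) 1
  val_inv := by
    rw [var, AddMonoidAlgebra.single_mul_single, ← Finsupp.single_add]
    simp [AddMonoidAlgebra.one_def]
  inv_val := by
    rw [var, AddMonoidAlgebra.single_mul_single, ← Finsupp.single_add]
    simp [AddMonoidAlgebra.one_def]

@[simp] theorem val_varUnit (v : V) : (varUnit v : LaurentRing V) = var v := rfl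

theorem val_varUnit_zpow (v : V) (n : ℤ) :
    ((varUnit v ^ n : (LaurentRing V)ˣ) : LaurentRing V) =
      AddMonoidAlgebra.single (Finsupp.single v n) 1 := by
  have step (m : ℤ) : AddMonoidAlgebra.single (Finsupp.single v (m + 1)) 1 =
      AddMonoidAlgebra.single (Finsupp.single v m) 1 * var v := by
    rw [var, AddMonoidAlgebra.single_mul_single, ← Finsupp.single_add, mul_one]
  induction n using Int.induction_on with
  | zero => simp [AddMonoidAlgebra.one_def]
  | succ m ih => rw [zpow_add_one, Units.val_mul, ih, step, val_varUnit]
  | pred m ih =>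
    rw [zpow_sub_one, Units.val_mul, ih, Units.mul_inv_eq_iff_eq_mul, val_varUnit, ← step,
      sub_add_cancel]

/-- An additive map that commutes with the variables is linear, because the variables are units and
generate the Laurent polynomial ring together with their inverses. -/
theorem map_smul_of_map_var_smul {M N : Type*} [AddCommGroup M] [AddCommGroup N]
    [Module (LaurentRing V) M] [Module (LaurentRing V) N] (f : M →+ N)
    (h : ∀ (v : V) (m : M), f (var v • m) = var v • f m) (r : LaurentRing V) (m : M) :
    f (r • m) = r • f m := by
  have hunit (v : V) (n : ℤ) (m : M) : f (varUnit v ^ n • m) = varUnit v ^ n • f m := by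
    induction n using Int.induction_on generalizing m with
    | zero => simp
    | succ k ih => rw [zpow_add_one, mul_smul, ih, mul_smul]; congr 1; exact h v m
    | pred k ih =>
      rw [zpow_sub_one, mul_smul, ih, mul_smul]
      congr 1
      rw [eq_inv_smul_iff, Units.smul_def, val_varUnit, ← h, ← val_varUnit, ← Units.smul_def,
        smul_inv_smul]
  have hmono (a : V →₀ ℤ) (m : M) : f ((AddMonoidAlgebra.single a 1 : LaurentRing V) • m) =
      (AddMonoidAlgebra.single a 1 : LaurentRing V) • f m := by
    induction a using Finsupp.induction generalizing m with
    | zero => simp [← AddMonoidAlgebra.one_def]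
    | single_add v n a _ _ ih =>
      have : (AddMonoidAlgebra.single (Finsupp.single v n + a) 1 : LaurentRing V) =
          ((varUnit v ^ n : (LaurentRing V)ˣ) : LaurentRing V) * AddMonoidAlgebra.single a 1 := by
        rw [val_varUnit_zpow, AddMonoidAlgebra.single_mul_single, mul_one]
      rw [this, mul_smul, mul_smul, ← Units.smul_def, hunit, ih, Units.smul_def]
  induction r using AddMonoidAlgebra.induction_on with
  | of a => exact hmono _ m
  | add x y hx hy => rw [add_smul, map_add, hx, hy, add_smul]
  | smul n x hx => rw [smul_assoc, map_zsmul, hx, smul_assoc]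

end LaurentRing

/-! ### A permutation representation of the group -/

section Lattice

variable {V R M : Type*} [Fintype V] [CommRing R] [AddCommGroup M] [Module R M]

/-- The action of `M` on `M × (V → ℤ)` by translations of the fibres: `q` translates the fibre
over `a` by `t ^ a • q`. -/
def fibreTranslation (t : V → Rˣ) : Multiplicative M →* Equiv.Perm (M × (V → ℤ)) where
  toFun q :=
    { toFun := fun p => (p.1 + ((∏ y, t y ^ p.2 y : Rˣ) : R) • q.toAdd, p.2)
      invFun := fun p => (p.1 - ((∏ y, t y ^ p.2 y : Rˣ) : R) • q.toAdd, p.2)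
      left_inv := fun p => by simp
      right_inv := fun p => by simp }
  map_one' := by ext p <;> simp
  map_mul' q q' := by
    ext p
    · simp
      abel
    · simp

theorem fibreTranslation_apply (t : V → Rˣ) (q : Multiplicative M) (p : M × (V → ℤ)) :
    fibreTranslation t q p = (p.1 + ((∏ y, t y ^ p.2 y : Rˣ) : R) • q.toAdd, p.2) := rfl

theorem fibreTranslation_injective (t : V → Rˣ) :
    Function.Injective (fibreTranslation (M := M) t) := fun q q' h => by
  have := congrArg Prod.fst (Equiv.congr_fun h ((0 : M), (0 : V → ℤ)))
  simpa [fibreTranslation_apply] using this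

variable [LinearOrder V]

/-- The permutation of `M × (V → ℤ)` that lifts the step in direction `v` of the lattice `V → ℤ`
by means of the `1`-form `latticePrimitive t E`. -/
noncomputable def latticeStep (t : V → Rˣ) (E : V → V → M) (v : V) :
    Equiv.Perm (M × (V → ℤ)) where
  toFun p := (p.1 + latticePrimitive t E v p.2, p.2 + Pi.single v 1)
  invFun p := (p.1 - latticePrimitive t E v (p.2 - Pi.single v 1), p.2 - Pi.single v 1)
  left_inv p := by simp
  right_inv p := by simp

theorem latticeStep_apply (t : V → Rˣ) (E : V → V → M) (v : V) (p : M × (V → ℤ)) :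
    latticeStep t E v p = (p.1 + latticePrimitive t E v p.2, p.2 + Pi.single v 1) := rfl

theorem fibreTranslation_mul_latticeStep (t : V → Rˣ) (E : V → V → M) (v : V) (q : M) :
    fibreTranslation t (Multiplicative.ofAdd q) * latticeStep t E v =
      latticeStep t E v * fibreTranslation t (Multiplicative.ofAdd ((t v : R) • q)) := by
  refine Equiv.ext fun p => ?_
  simp only [Equiv.Perm.mul_apply, latticeStep_apply, fibreTranslation_apply, toAdd_ofAdd]
  refine Prod.ext ?_ rfl
  rw [prod_zpow_add_single, if_pos (Finset.mem_univ v), smul_smul, Units.val_mul,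
    mul_comm (t v : R)]
  exact add_right_comm _ _ _

/-- Going around a square of the lattice translates the fibres by the curl of
`latticePrimitive t E`. The inverses of the steps are used so that conjugation by the image of the
generator `v` multiplies translations by `t v` rather than by its inverse. -/
theorem commutator_latticeStep_inv (t : V → Rˣ) (E : V → V → M)
    (hE : ∀ u w x, u < w → w < x →
      ((t u : R) - 1) • E w x - ((t w : R) - 1) • E u x + ((t x : R) - 1) • E u w = 0)
    {u w : V} (h : u < w) :
    ⁅(latticeStep t E u)⁻¹, (latticeStep t E w)⁻¹⁆ =
      fibreTranslation t (Multiplicative.ofAdd (E u w)) := by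
  have : latticeStep t E u * latticeStep t E w =
      latticeStep t E w * latticeStep t E u *
        fibreTranslation t (Multiplicative.ofAdd (E u w)) := by
    refine Equiv.ext fun p => ?_
    simp only [Equiv.Perm.mul_apply, latticeStep_apply, fibreTranslation_apply, toAdd_ofAdd]
    refine Prod.ext ?_ (add_right_comm _ _ _)
    simp only [← latticePrimitive_curl t E hE h]
    abel
  rw [commutatorElement_def, inv_inv, inv_inv, mul_assoc, this]
  group

end Lattice

namespace RightAngledArtinGroup

open AlexanderInvariant

variable {V : Type*} (Γ : SimpleGraph V)

theorem normal_of_conj_generator_mem (K : Subgroup (RightAngledArtinGroup Γ))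
    (h : ∀ (v : V), ∀ x ∈ K, PresentedGroup.of v * x * (PresentedGroup.of v)⁻¹ ∈ K)
    (h' : ∀ (v : V), ∀ x ∈ K, (PresentedGroup.of v)⁻¹ * x * PresentedGroup.of v ∈ K) :
    K.Normal := by
  rw [← Subgroup.normalizer_eq_top_iff, eq_top_iff, ← PresentedGroup.closure_range_of,
    Subgroup.closure_le]
  rintro _ ⟨v, rfl⟩
  refine Subgroup.mem_normalizer_iff.2 fun x => ⟨h v x, fun hx => ?_⟩
  simpa [mul_assoc] using h' v _ hx

variable [Fintype V] [LinearOrder V] {M : Type*} [AddCommGroup M] [Module (LaurentRing V) M]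

/-- The universal property of `B(G_Γ)`: a family `E` in a module that satisfies the Jacobi identity
and vanishes on the edges of `Γ` is the family of values of a linear map at the commutators of the
generators. The group acts on `M × (V → ℤ)` by the inverses of the maps `latticeStep`, its
commutator subgroup acts by fibre translations, and the map sends the class of an element of `G'`
to the element of `M` by which it translates. -/
theorem exists_linearMap_bracket (E : V → V → M)
    (hE : ∀ u w x, u < w → w < x → (LaurentRing.var u - 1) • E w x -
      (LaurentRing.var w - 1) • E u x + (LaurentRing.var x - 1) • E u w = 0)
    (hadj : ∀ u w, u < w → Γ.Adj u w → E u w = 0) :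
    ∃ ψ : AlexanderInvariant (RightAngledArtinGroup Γ) →ₗ[LaurentRing V] M,
      ∀ u w, u < w → ψ (bracket (PresentedGroup.of u) (PresentedGroup.of w)) = E u w := by
  let t : V → (LaurentRing V)ˣ := LaurentRing.varUnit
  let τ : Multiplicative M →* Equiv.Perm (M × (V → ℤ)) := fibreTranslation t
  let φ : RightAngledArtinGroup Γ →* Equiv.Perm (M × (V → ℤ)) :=
    PresentedGroup.toGroup (f := fun v => (latticeStep t E v)⁻¹) (by
      rintro _ ⟨u, w, huw, rfl⟩
      rw [map_commutatorElement, FreeGroup.lift_apply_of, FreeGroup.lift_apply_of]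
      rcases huw.ne.lt_or_gt with h | h
      · rw [commutator_latticeStep_inv t E hE h, hadj u w h huw, ofAdd_zero, map_one]
      · rw [← commutatorElement_inv, commutator_latticeStep_inv t E hE h, hadj w u h huw.symm,
          ofAdd_zero, map_one, inv_one])
  have hφ (v : V) : φ (PresentedGroup.of v) = (latticeStep t E v)⁻¹ := PresentedGroup.toGroup.of _
  have hbr {u w : V} (h : u < w) :
      φ ⁅(PresentedGroup.of u : RightAngledArtinGroup Γ), PresentedGroup.of w⁆ =
      τ (Multiplicative.ofAdd (E u w)) := by
    rw [map_commutatorElement, hφ, hφ, commutator_latticeStep_inv t E hE h]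
  have hconj (v : V) (q : M) : (latticeStep t E v)⁻¹ * τ (Multiplicative.ofAdd q) *
      latticeStep t E v = τ (Multiplicative.ofAdd (LaurentRing.var v • q)) := by
    rw [mul_assoc, fibreTranslation_mul_latticeStep, inv_mul_cancel_left]
    rfl
  have hconj' (v : V) (q : M) : latticeStep t E v * τ (Multiplicative.ofAdd q) *
      (latticeStep t E v)⁻¹ = τ (Multiplicative.ofAdd ((t v)⁻¹ • q)) := by
    rw [mul_inv_eq_iff_eq_mul, fibreTranslation_mul_latticeStep, ← Units.smul_def, smul_inv_smul]
  have hnormal : (τ.range.comap φ).Normal := by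
    refine normal_of_conj_generator_mem Γ _ ?_ ?_
    · rintro v x ⟨q, hq⟩
      refine ⟨_, (hconj v q.toAdd).symm.trans ?_⟩
      rw [map_mul, map_mul, map_inv, hφ, inv_inv, ← hq]
      rfl
    · rintro v x ⟨q, hq⟩
      refine ⟨_, (hconj' v q.toAdd).symm.trans ?_⟩
      rw [map_mul, map_mul, map_inv, hφ, inv_inv, ← hq]
      rfl
  have hle : commutator (RightAngledArtinGroup Γ) ≤ τ.range.comap φ := by
    refine commutator_le_of_closure_eq_top (PresentedGroup.closure_range_of _) _ ?_
    rintro _ ⟨u, rfl⟩ _ ⟨w, rfl⟩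
    rcases lt_trichotomy u w with h | rfl | h
    · exact ⟨_, (hbr h).symm⟩
    · rw [commutatorElement_self]
      exact one_mem _
    · rw [← commutatorElement_inv]
      exact inv_mem ⟨_, (hbr h).symm⟩
  let θ : commutator (RightAngledArtinGroup Γ) →* Multiplicative M :=
    (MonoidHom.ofInjective (fibreTranslation_injective t)).symm.toMonoidHom.comp
      ((φ.comp (commutator _).subtype).codRestrict τ.range fun x => hle x.2)
  have hθ (x) : τ (θ x) = φ x := congrArg Subtype.val
    ((MonoidHom.ofInjective (fibreTranslation_injective t)).apply_symm_apply ⟨φ x, hle x.2⟩)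
  let ψ : AlexanderInvariant (RightAngledArtinGroup Γ) →+ M :=
    MonoidHom.toAdditiveLeft (Abelianization.lift θ)
  have hψ (x) : τ (Multiplicative.ofAdd (ψ (mk x))) = φ x := hθ x
  refine ⟨{ ψ with map_smul' := LaurentRing.map_smul_of_map_var_smul ψ fun v b => ?_ },
    fun u w h => ?_⟩
  · obtain ⟨x, rfl⟩ := mk_surjective b
    refine Multiplicative.ofAdd.injective (fibreTranslation_injective t ?_)
    change τ _ = τ _
    rw [var_smul_mk, hψ, ← hconj, hψ, MulAut.conjNormal_apply, map_mul, map_mul, map_inv, hφ,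
      inv_inv]
  · refine Multiplicative.ofAdd.injective (fibreTranslation_injective t ?_)
    exact (hψ _).trans (hbr h)

end RightAngledArtinGroup

/-! ### The relators -/

theorem Finset.exists_lt_lt_of_card_eq_three {α : Type*} [LinearOrder α] {t : Finset α}
    (h : t.card = 3) : ∃ a b c, a < b ∧ b < c ∧ t = {a, b, c} := by
  let f := t.orderEmbOfFin h
  refine ⟨f 0, f 1, f 2, f.strictMono (by decide), f.strictMono (by decide), ?_⟩
  have := Finset.image_orderEmbOfFin_univ t h
  rw [← this]
  ext x
  simp only [Finset.mem_image, Finset.mem_univ, true_and, Finset.mem_insert,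
    Finset.mem_singleton, Fin.exists_fin_succ, IsEmpty.exists_iff, or_false]
  simp [f, eq_comm]

section Relators

variable {V : Type*} [LinearOrder V] (Γ : SimpleGraph V) [DecidableRel Γ.Adj]

/-- The basis element of the free module on the non-edges given by `{u, w}` if this is a non-edge,
and `0` otherwise. -/
noncomputable def nonEdgeSingle (u w : V) : Γᶜ.edgeSet →₀ LaurentRing V :=
  if h : s(u, w) ∈ Γᶜ.edgeSet then Finsupp.single ⟨s(u, w), h⟩ 1 else 0

theorem nonEdgeSingle_of_adj {u w : V} (h : Γ.Adj u w) : nonEdgeSingle Γ u w = 0 :=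
  dif_neg (by simp [h])

theorem sum_subtype_filter_mem {α N : Type*} [DecidableEq α] [AddCommMonoid N] {p : α → Prop}
    [DecidablePred p] [Fintype {x // p x}] (T : Finset α) (F : {x // p x} → N) :
    ∑ e : {x // p x} with e.1 ∈ T, F e = ∑ z ∈ T, if h : p z then F ⟨z, h⟩ else 0 := by
  refine Finset.sum_of_injOn Subtype.val Subtype.val_injective.injOn ?_ ?_ ?_
  · intro e he
    simpa using he
  · intro z hz hz'
    refine dif_neg fun h => hz' ⟨⟨z, h⟩, by simpa using hz, rfl⟩
  · intro e _
    rw [dif_pos e.2]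

/-- The relator of `{a, b, c}` with `a < b < c` is the left-hand side of the Jacobi identity. -/
theorem alexanderRelator_triple [Fintype V] {a b c : V} (hab : a < b) (hbc : b < c) :
    alexanderRelator Γ {a, b, c} = (LaurentRing.var a - 1) • nonEdgeSingle Γ b c -
      (LaurentRing.var b - 1) • nonEdgeSingle Γ a c +
      (LaurentRing.var c - 1) • nonEdgeSingle Γ a b := by
  have hac := hab.trans hbc
  have hT (e : Γᶜ.edgeSet) : e.1.toFinset ⊆ {a, b, c} ↔
      e.1 ∈ ({s(b, c), s(a, c), s(a, b)} : Finset (Sym2 V)) := by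
    obtain ⟨z, hz⟩ := e
    induction z with | _ x y
    have hxy : x ≠ y := (Γᶜ.mem_edgeSet.1 hz).ne
    simp only [Sym2.toFinset_mk_eq, Finset.insert_subset_iff, Finset.singleton_subset_iff,
      Finset.mem_insert, Finset.mem_singleton, Sym2.eq_iff]
    grind
  have hsum : alexanderRelator Γ {a, b, c} =
      ∑ z ∈ ({s(b, c), s(a, c), s(a, b)} : Finset (Sym2 V)), if h : z ∈ Γᶜ.edgeSet then
        ∑ v ∈ {a, b, c} \ z.toFinset, Finsupp.single (⟨z, h⟩ : Γᶜ.edgeSet)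
          (tripleSign v z.inf z.sup • (LaurentRing.var v - 1)) else 0 := by
    refine Eq.trans ?_ (sum_subtype_filter_mem (p := (· ∈ Γᶜ.edgeSet)) _ fun e =>
      ∑ v ∈ {a, b, c} \ e.1.toFinset, Finsupp.single e
        (tripleSign v e.1.inf e.1.sup • (LaurentRing.var v - 1)))
    simp only [alexanderRelator, hT]
  have hbc' : ({a, b, c} : Finset V) \ (s(b, c)).toFinset = {a} := by
    ext x; simp [Sym2.toFinset_mk_eq]; grind
  have hac' : ({a, b, c} : Finset V) \ (s(a, c)).toFinset = {b} := by
    ext x; simp [Sym2.toFinset_mk_eq]; grind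
  have hab' : ({a, b, c} : Finset V) \ (s(a, b)).toFinset = {c} := by
    ext x; simp [Sym2.toFinset_mk_eq]; grind
  have hsmul (u w : V) (r : LaurentRing V) : (if h : s(u, w) ∈ Γᶜ.edgeSet then
      Finsupp.single (⟨s(u, w), h⟩ : Γᶜ.edgeSet) r else 0) = r • nonEdgeSingle Γ u w := by
    unfold nonEdgeSingle
    split_ifs <;> simp
  rw [hsum, Finset.sum_insert (by simp [hab.ne', hac.ne', hbc.ne', hbc.ne]),
    Finset.sum_insert (by simp [hab.ne, hbc.ne']),
    Finset.sum_singleton]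
  simp only [hbc', hac', hab', Finset.sum_singleton, hsmul, Sym2.inf_mk, Sym2.sup_mk,
    inf_eq_left.2 hab.le, inf_eq_left.2 hac.le, inf_eq_left.2 hbc.le,
    sup_eq_right.2 hab.le, sup_eq_right.2 hac.le, sup_eq_right.2 hbc.le]
  have h1 : tripleSign a b c = 1 := by simp [tripleSign, hab.not_gt, hac.not_gt, hbc.not_gt]
  have h2 : tripleSign b a c = -1 := by simp [tripleSign, hab, hac.not_gt, hbc.not_gt]
  have h3 : tripleSign c a b = 1 := by simp [tripleSign, hab.not_gt, hac, hbc]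
  rw [h1, h2, h3, one_smul, one_smul, neg_smul, one_smul, neg_smul]
  abel

/-- The relators of `3`-cliques vanish, so that all triples may be treated alike. -/
theorem alexanderRelator_of_isNClique [Fintype V] {t : Finset V} (ht : Γ.IsNClique 3 t) :
    alexanderRelator Γ t = 0 := by
  obtain ⟨a, b, c, hab, hbc, rfl⟩ := Finset.exists_lt_lt_of_card_eq_three ht.card_eq
  have h := ht.isClique
  rw [alexanderRelator_triple Γ hab hbc,
    nonEdgeSingle_of_adj Γ (h (by simp) (by simp) hbc.ne),
    nonEdgeSingle_of_adj Γ (h (by simp) (by simp) (hab.trans hbc).ne),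
    nonEdgeSingle_of_adj Γ (h (by simp) (by simp) hab.ne)]
  simp

end Relators

namespace RightAngledArtinGroup

open AlexanderInvariant

variable {V : Type*} (Γ : SimpleGraph V)

theorem bracket_of_adj {u w : V} (h : Γ.Adj u w) :
    bracket (PresentedGroup.of u : RightAngledArtinGroup Γ) (PresentedGroup.of w) = 0 := by
  refine (congrArg mk (Subtype.ext ?_)).trans mk_one
  change ⁅PresentedGroup.mk _ (FreeGroup.of u), PresentedGroup.mk _ (FreeGroup.of w)⁆ = 1
  rw [← map_commutatorElement]
  exact PresentedGroup.one_of_mem ⟨u, w, h, rfl⟩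

theorem groupRingEquiv_smul_mk (g : RightAngledArtinGroup Γ)
    (x : commutator (RightAngledArtinGroup Γ)) :
    groupRingEquiv Γ (MonoidAlgebra.single (Abelianization.of g) 1) • mk x =
      mk (MulAut.conjNormal g x) := by
  change (groupRingEquiv Γ).symm (groupRingEquiv Γ _) • mk x = _
  rw [RingEquiv.symm_apply_apply, single_of_smul_mk]

theorem var_smul (v : V) (b : AlexanderInvariant (RightAngledArtinGroup Γ)) :
    LaurentRing.var v • b = conjHom _ (PresentedGroup.of v) b := by
  obtain ⟨x, rfl⟩ := mk_surjective b
  exact var_smul_mk Γ v x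

theorem bracket_jacobi (a b c : V) :
    (LaurentRing.var a - 1) •
        bracket (PresentedGroup.of b : RightAngledArtinGroup Γ) (PresentedGroup.of c) -
      (LaurentRing.var b - 1) •
        bracket (PresentedGroup.of a : RightAngledArtinGroup Γ) (PresentedGroup.of c) +
      (LaurentRing.var c - 1) •
        bracket (PresentedGroup.of a : RightAngledArtinGroup Γ) (PresentedGroup.of b) = 0 := by
  simp only [sub_smul, one_smul, var_smul]
  exact conjHom_bracket_jacobi _ _ _

/-- The elements of `G'` with class in a submodule `N` of `G'/G''` form a normal subgroup of `G`,
so it contains `G'` as soon as it contains the commutators of the generators. -/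
theorem eq_top_of_bracket_mem
    (N : Submodule (LaurentRing V) (AlexanderInvariant (RightAngledArtinGroup Γ)))
    (h : ∀ u w : V, bracket (PresentedGroup.of u) (PresentedGroup.of w) ∈ N) : N = ⊤ := by
  let K : Subgroup (RightAngledArtinGroup Γ) :=
    { carrier := {g | ∃ hg : g ∈ commutator _, mk ⟨g, hg⟩ ∈ N}
      mul_mem' := by
        rintro x y ⟨hx, hx'⟩ ⟨hy, hy'⟩
        refine ⟨mul_mem hx hy, ?_⟩
        have := N.add_mem hx' hy'
        rwa [← mk_mul] at this
      one_mem' := by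
        refine ⟨one_mem _, ?_⟩
        have := N.zero_mem
        rwa [← mk_one] at this
      inv_mem' := by
        rintro x ⟨hx, hx'⟩
        refine ⟨inv_mem hx, ?_⟩
        have := N.neg_mem hx'
        rwa [← mk_inv] at this }
  have : K.Normal := ⟨by
    rintro x ⟨hx, hx'⟩ g
    refine ⟨(MulAut.conjNormal g (⟨x, hx⟩ : commutator _)).2, ?_⟩
    have := N.smul_mem (groupRingEquiv Γ (MonoidAlgebra.single (Abelianization.of g) 1)) hx'
    rwa [groupRingEquiv_smul_mk] at this⟩
  have hK : commutator (RightAngledArtinGroup Γ) ≤ K := by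
    refine commutator_le_of_closure_eq_top (PresentedGroup.closure_range_of _) K ?_
    rintro _ ⟨u, rfl⟩ _ ⟨w, rfl⟩
    exact ⟨_, h u w⟩
  refine eq_top_iff.2 fun b _ => ?_
  obtain ⟨x, rfl⟩ := mk_surjective b
  exact (hK x.2).2

end RightAngledArtinGroup

/-! ### The isomorphism -/

open AlexanderInvariant RightAngledArtinGroup in
theorem theorem4p1 {V : Type*} [Fintype V] [LinearOrder V] (Γ : SimpleGraph V)
    [DecidableRel Γ.Adj] :
    Nonempty (AlexanderInvariant (RightAngledArtinGroup Γ)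
      ≃ₗ[LaurentRing V] AlexanderPresentation Γ) := by
  let br (u w : V) : AlexanderInvariant (RightAngledArtinGroup Γ) :=
    bracket (PresentedGroup.of u) (PresentedGroup.of w)
  let S : Submodule (LaurentRing V) (Γᶜ.edgeSet →₀ LaurentRing V) :=
    Submodule.span (LaurentRing V)
      {r | ∃ t : Finset V, t.card = 3 ∧ ¬ Γ.IsNClique 3 t ∧ r = alexanderRelator Γ t}
  let Φ : (Γᶜ.edgeSet →₀ LaurentRing V) →ₗ[LaurentRing V]
      AlexanderInvariant (RightAngledArtinGroup Γ) :=
    Finsupp.linearCombination (LaurentRing V) fun e => br e.1.inf e.1.sup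
  have hΦ {u w : V} (h : u < w) : Φ (nonEdgeSingle Γ u w) = br u w := by
    by_cases hadj : Γ.Adj u w
    · rw [nonEdgeSingle_of_adj Γ hadj, map_zero]
      exact (bracket_of_adj Γ hadj).symm
    · rw [nonEdgeSingle, dif_pos (by simp [hadj, h.ne]), Finsupp.linearCombination_single, one_smul,
        Sym2.inf_mk, Sym2.sup_mk, inf_eq_left.2 h.le, sup_eq_right.2 h.le]
  have hS : S ≤ LinearMap.ker Φ := by
    refine Submodule.span_le.2 ?_
    rintro _ ⟨t, ht, -, rfl⟩
    obtain ⟨a, b, c, hab, hbc, rfl⟩ := Finset.exists_lt_lt_of_card_eq_three ht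
    rw [SetLike.mem_coe, LinearMap.mem_ker, alexanderRelator_triple Γ hab hbc, map_add, map_sub,
      map_smul, map_smul, map_smul, hΦ hab, hΦ hbc, hΦ (hab.trans hbc)]
    exact bracket_jacobi Γ a b c
  have hmem {a b c : V} (hab : a < b) (hbc : b < c) : alexanderRelator Γ {a, b, c} ∈ S := by
    by_cases ht : Γ.IsNClique 3 {a, b, c}
    · rw [alexanderRelator_of_isNClique Γ ht]
      exact S.zero_mem
    · refine Submodule.subset_span ⟨_, ?_, ht, rfl⟩
      exact Finset.card_eq_three.2 ⟨a, b, c, hab.ne, (hab.trans hbc).ne, hbc.ne, rfl⟩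
  obtain ⟨ψ, hψ⟩ := exists_linearMap_bracket Γ (M := AlexanderPresentation Γ)
    (fun u w => S.mkQ (nonEdgeSingle Γ u w))
    (fun u w x huw hwx => by
      rw [← map_smul, ← map_smul, ← map_smul, ← map_sub, ← map_add,
        ← alexanderRelator_triple Γ huw hwx]
      exact (Submodule.Quotient.mk_eq_zero S).2 (hmem huw hwx))
    (fun u w _ h => by rw [nonEdgeSingle_of_adj Γ h, map_zero])
  let Φ' : AlexanderPresentation Γ →ₗ[LaurentRing V]
      AlexanderInvariant (RightAngledArtinGroup Γ) := S.liftQ Φ hS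
  -- Both maps respect the images of the basis elements, which generate the source of `Φ'`.
  have hleft : ψ.comp Φ' = LinearMap.id := by
    refine Submodule.linearMap_qext _ (Finsupp.lhom_ext' fun e => LinearMap.ext_ring ?_)
    obtain ⟨z, hz⟩ := e
    induction z using Sym2.inductionOn with | _ u w
    wlog h : u < w generalizing u w
    · have := this w u (by rwa [Sym2.eq_swap])
        (lt_of_le_of_ne (not_lt.1 h) (Γᶜ.mem_edgeSet.1 hz).ne')
      simpa only [Sym2.eq_swap (a := w)] using this
    have hs : nonEdgeSingle Γ u w = Finsupp.single ⟨s(u, w), hz⟩ 1 := dif_pos hz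
    change ψ (Φ (Finsupp.single ⟨s(u, w), hz⟩ 1)) = S.mkQ (Finsupp.single ⟨s(u, w), hz⟩ 1)
    rw [← hs, hΦ h]
    exact hψ u w h
  have hsurj : LinearMap.range Φ' = ⊤ := by
    have hlt {u w : V} (h : u < w) : br u w ∈ LinearMap.range Φ' :=
      ⟨S.mkQ (nonEdgeSingle Γ u w), hΦ h⟩
    refine eq_top_of_bracket_mem Γ _ fun u w => ?_
    rcases lt_trichotomy u w with h | rfl | h
    · exact hlt h
    · have : br u u = 0 := (congrArg mk (Subtype.ext (commutatorElement_self _))).trans mk_one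
      change br u u ∈ _
      rw [this]
      exact Submodule.zero_mem _
    · rw [bracket_swap]
      exact Submodule.neg_mem _ (hlt h)
  exact ⟨(LinearEquiv.ofBijective Φ' ⟨LinearMap.injective_of_comp_eq_id _ _ hleft,
    LinearMap.range_eq_top.1 hsurj⟩).symm⟩
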